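/- A (non-degenerate) cycle set is a non-empty set $X$ with a binary operation $\cdot$ such that every map $\sigma_x:y\mapsto x\cdot y$ is bijective, the map $x\mapsto x\cdot x$ is bijective, and $(x\cdot y)\cdot(x\cdot z)=(y\cdot x)\cdot(y\cdot z)$ for all $x,y,z\in X$. Let $\mathcal{G}(X)=\langle\sigma_x : x\in X\rangle\le \mathrm{Sym}(X)$. We call $X$ indecomposable if $\mathcal{G}(X)$ is transitive on $X$, and irretractable if $\sigma_x=\sigma_y$ implies $x=y$. The group $\mathcal{G}(X)$, with composition $\circ$, carries a unique addition $+$ such that $(\mathcal{G}(X),+,\circ)$ is a left brace (that is, $(\mathcal{G}(X),+)$ is an abelian group and $a\circ(b+c)+a=a\circ b+a\circ c$ for all $a,b,c$) and $g+\sigma_x^{-1}=g\circ\sigma_{g^{-1}(x)}^{-1}$ for all $g\in\mathcal{G}(X)$, $x\in X$. If $\alpha$ is an automorphism of a cycle set $(Y,\cdot)$, the deformation $Y_\alpha$ is the cycle set on $Y$ with operation $x\cdot_\alpha y=\alpha(x\cdot y)$. **Theorem.** Let $X$ be an indecomposable and irretractable cycle set of size $p^n$, where $p$ is a prime number, and let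 $B_p$ be the Sylow $p$-subgroup of $(\mathcal{G}(X),+)$ (it is also a subgroup of $(\mathcal{G}(X),\circ)$, hence a left brace under the operations of $\mathcal{G}(X)$). The following are equivalent: 1. $B_p$ is a normal subgroup of $(\mathcal{G}(X),\circ)$. 2. $X$ is isomorphic to a deformation $Y_\alpha$ of a cycle set $Y$ by an automorphism $\alpha$ of $Y$ such that $\mathcal{G}(Y)\cong B_p$ as groups (with respect to $\circ$), $\alpha$ has order coprime to $p$, and $\alpha$ fixes an element of $Y$. 3. The same as 2, with $\mathcal{G}(Y)\cong B_p$ as left braces. -/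

import Mathlib

universe u v

/-- A left brace structure on a group `(B, ∘)` (the group law `∘` is written `*`): an abelian group
structure `+` on `B` with `x ∘ (y + z) + x = x ∘ y + x ∘ z`. -/
class LeftBrace (B : Type u) [Group B] extends AddCommGroup B where
  mul_add_add : ∀ x y z : B, x * (y + z) + x = x * y + x * z

/-- A (non-degenerate) cycle set: a left quasigroup `(X, ·)`, with `x · y` written `op x y`,
such that `(x · y) · (x · z) = (y · x) · (y · z)` and the squaring map is bijective. -/
class CycleSet (X : Type u) where
  op : X → X → X
  bijective_op : ∀ x, Function.Bijective (op x)
  cycle : ∀ x y z, op (op x y) (op x z) = op (op y x) (op y z)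
  bijective_sq : Function.Bijective fun x => op x x

namespace LeftBrace

variable {B : Type u} [Group B] [LeftBrace B]

theorem mul_add (x y z : B) : x * (y + z) = x * y + x * z - x :=
  eq_sub_of_add_eq (mul_add_add x y z)

theorem mul_zero (x : B) : x * 0 = x := by
  have h := mul_add_add x 0 0
  rw [add_zero] at h
  exact (add_left_cancel h).symm

theorem zero_eq_one : (0 : B) = 1 := by
  have h := mul_zero (1 : B)
  rwa [one_mul] at h

/-- The map `λ_x : y ↦ -x + x ∘ y`, an automorphism of `(B, +)`. -/
def lam (x : B) : B ≃+ B where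
  toFun y := -x + x * y
  invFun y := -x⁻¹ + x⁻¹ * y
  left_inv y := by
    have h1 : x⁻¹ * (-x + x * y) = x⁻¹ * (-x) + y - x⁻¹ := by
      rw [mul_add, inv_mul_cancel_left]
    have h2 : x⁻¹ * (-x) = x⁻¹ + x⁻¹ := by
      have h := mul_add x⁻¹ (-x) x
      rw [neg_add_cancel, mul_zero, inv_mul_cancel, ← zero_eq_one, add_zero] at h
      exact (eq_add_of_sub_eq h.symm)
    beta_reduce
    rw [h1, h2]; abel
  right_inv y := by
    have h1 : x * (-x⁻¹ + x⁻¹ * y) = x * (-x⁻¹) + y - x := by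
      rw [mul_add, mul_inv_cancel_left]
    have h2 : x * (-x⁻¹) = x + x := by
      have h := mul_add x (-x⁻¹) x⁻¹
      rw [neg_add_cancel, mul_zero, mul_inv_cancel, ← zero_eq_one, add_zero] at h
      exact (eq_add_of_sub_eq h.symm)
    beta_reduce
    rw [h1, h2]; abel
  map_add' y z := by
    rw [mul_add]; abel

theorem mul_eq_add_lam (x y : B) : x * y = x + lam x y := by
  change x * y = x + (-x + x * y)
  abel

theorem inv_eq_neg_lam (x : B) : x⁻¹ = -lam x⁻¹ x := by
  change x⁻¹ = -(-x⁻¹ + x⁻¹ * x)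
  rw [inv_mul_cancel, ← zero_eq_one, add_zero, neg_neg]

/-- Sylow subgroups of `(B, +)` are left ideals. -/
theorem lam_mem_sylow [Finite B] {p : ℕ} [Fact p.Prime] (P : Sylow p (Multiplicative B)) (x : B)
    {y : B} (hy : Multiplicative.ofAdd y ∈ P) : Multiplicative.ofAdd (lam x y) ∈ P := by
  have hN : (P : Subgroup (Multiplicative B)).Normal := inferInstance
  have hC := P.characteristic_of_normal hN
  have h := hC.fixed (AddEquiv.toMultiplicative (lam x))
  have hy' : Multiplicative.ofAdd y ∈
      (P : Subgroup (Multiplicative B)).comap (AddEquiv.toMultiplicative (lam x)).toMonoidHom := by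
    rw [h]; exact hy
  exact hy'

/-- A Sylow subgroup `P` of the additive group `(B, +)` of a finite left brace, viewed as a
subgroup of the multiplicative group `(B, ∘)`. It has the same elements as `P`. -/
def sylow [Finite B] {p : ℕ} [Fact p.Prime] (P : Sylow p (Multiplicative B)) : Subgroup B where
  carrier := {b | Multiplicative.ofAdd b ∈ P}
  one_mem' := by
    change Multiplicative.ofAdd (1 : B) ∈ P
    rw [← zero_eq_one]
    exact P.one_mem
  mul_mem' {a b} ha hb := by
    change Multiplicative.ofAdd (a * b) ∈ P
    rw [mul_eq_add_lam]
    exact P.mul_mem ha (lam_mem_sylow P a hb)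
  inv_mem' {a} ha := by
    change Multiplicative.ofAdd a⁻¹ ∈ P
    rw [inv_eq_neg_lam]
    exact P.inv_mem (lam_mem_sylow P a⁻¹ ha)

section Sylow

variable [Finite B] {p : ℕ} [Fact p.Prime] (P : Sylow p (Multiplicative B))

instance : Zero (sylow P) := ⟨⟨0, P.one_mem⟩⟩

instance : Add (sylow P) := ⟨fun a b => ⟨a.1 + b.1, P.mul_mem a.2 b.2⟩⟩

instance : Neg (sylow P) := ⟨fun a => ⟨-a.1, P.inv_mem a.2⟩⟩

/-- A Sylow subgroup of `(B, +)` is a left brace under the operations of `B`. -/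
instance : LeftBrace (sylow P) where
  nsmul := nsmulRec
  zsmul := zsmulRec
  add_assoc a b c := Subtype.ext (add_assoc a.1 b.1 c.1)
  zero_add a := Subtype.ext (zero_add a.1)
  add_zero a := Subtype.ext (add_zero a.1)
  neg_add_cancel a := Subtype.ext (neg_add_cancel a.1)
  add_comm a b := Subtype.ext (add_comm a.1 b.1)
  mul_add_add a b c := Subtype.ext (mul_add_add a.1 b.1 c.1)

end Sylow

end LeftBrace

/-- An isomorphism of left braces: a bijection preserving both operations. -/
structure LeftBraceIso (B : Type u) (C : Type v) [Group B] [LeftBrace B] [Group C] [LeftBrace C]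
    extends B ≃* C where
  map_add : ∀ x y : B, toFun (x + y) = toFun x + toFun y

namespace CycleSet

/-- The permutation `σ_x : y ↦ x · y`. -/
noncomputable def sigma {X : Type u} [CycleSet X] (x : X) : Equiv.Perm X :=
  Equiv.ofBijective (op x) (bijective_op x)

/-- The associated permutation group `𝒢(X)`, generated by all `σ_x`. -/
def permGroup (X : Type u) [CycleSet X] : Subgroup (Equiv.Perm X) :=
  Subgroup.closure (Set.range (sigma (X := X)))

/-- `X` is indecomposable if `𝒢(X)` is transitive on `X`. -/
def Indecomposable (X : Type u) [CycleSet X] : Prop :=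
  MulAction.IsPretransitive (permGroup X) X

/-- `X` is irretractable if `σ_x = σ_y` only for `x = y`. -/
def Irretractable (X : Type u) [CycleSet X] : Prop :=
  Function.Injective (sigma (X := X))

/-- `f` is an isomorphism of cycle sets. -/
def IsIso {X : Type u} {Y : Type v} [CycleSet X] [CycleSet Y] (f : X ≃ Y) : Prop :=
  ∀ x y, f (op x y) = op (f x) (f y)

/-- The automorphism group of a cycle set. -/
def aut (X : Type u) [CycleSet X] : Subgroup (Equiv.Perm X) where
  carrier := {f | IsIso f}
  one_mem' _ _ := rfl
  mul_mem' {f g} hf hg x y := by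
    change f (g (op x y)) = op (f (g x)) (f (g y))
    rw [hg, hf]
  inv_mem' {f} hf x y := by
    apply f.injective
    rw [hf]
    simp

/-- The underlying set of the deformation `X_α` of `X` by an automorphism `α`. -/
def Deformation {X : Type u} [CycleSet X] (_α : aut X) : Type u := X

/-- The deformation `X_α`, with operation `x ·_α y = α (x · y)`. -/
instance {X : Type u} [CycleSet X] (α : aut X) : CycleSet (Deformation α) where
  op x y := α.1 (op (X := X) x y)
  bijective_op x := α.1.bijective.comp (bijective_op (X := X) x)
  cycle x y z := by
    have h : ∀ a b : X, α.1 (op a b) = op (α.1 a) (α.1 b) := α.2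
    rw [← h, ← h]
    exact congrArg (fun t => α.1 (α.1 t)) (cycle (X := X) x y z)
  bijective_sq := α.1.bijective.comp (bijective_sq (X := X))

section Brace

variable {X : Type u} [CycleSet X]

/-- `σ_x` as an element of `𝒢(X)`. -/
noncomputable def sig (x : X) : permGroup X :=
  ⟨sigma x, Subgroup.subset_closure ⟨x, rfl⟩⟩

theorem sig_smul (x y : X) : sig x • y = op x y := rfl

theorem sig_mul_sig (x y : X) : sig (op x y) * sig x = sig (op y x) * sig y := by
  apply Subtype.ext
  ext z
  exact cycle x y z

/-- The permutation `g ↦ g ∘ σ_{g⁻¹(x)}⁻¹` of `𝒢(X)`. In the left brace `𝒢(X)` this is the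
translation `g ↦ g + σ_x⁻¹`. -/
noncomputable def translate (x : X) : Equiv.Perm (permGroup X) where
  toFun g := g * (sig (g⁻¹ • x))⁻¹
  invFun k := k * sig ((Equiv.ofBijective _ (bijective_sq (X := X))).symm (k⁻¹ • x))
  left_inv g := by
    have h : (Equiv.ofBijective _ (bijective_sq (X := X))).symm
        ((g * (sig (g⁻¹ • x))⁻¹)⁻¹ • x) = g⁻¹ • x := by
      rw [Equiv.symm_apply_eq, mul_inv_rev, inv_inv, mul_smul, sig_smul]
      rfl
    beta_reduce
    rw [h, inv_mul_cancel_right]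
  right_inv k := by
    have h : ∀ u : X, op u u = k⁻¹ • x → (k * sig u)⁻¹ • x = u := by
      intro u hu
      rw [mul_inv_rev, mul_smul, ← hu, ← sig_smul, inv_smul_smul]
    have h' := h _ ((Equiv.ofBijective _ (bijective_sq (X := X))).apply_symm_apply (k⁻¹ • x))
    beta_reduce
    rw [h', mul_inv_cancel_right]

theorem translate_apply (x : X) (g : permGroup X) :
    translate x g = g * (sig (g⁻¹ • x))⁻¹ := rfl

theorem translate_comm (x y : X) : translate x * translate y = translate y * translate x := by
  have key : ∀ (x y : X) (g : permGroup X), (translate x * translate y) g =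
      g * (sig (op (g⁻¹ • y) (g⁻¹ • x)) * sig (g⁻¹ • y))⁻¹ := by
    intro x y g
    rw [Equiv.Perm.mul_apply, translate_apply, translate_apply, mul_inv_rev, inv_inv, mul_smul,
      sig_smul, mul_inv_rev, mul_assoc]
  ext1 g
  rw [key, key, sig_mul_sig]

theorem translate_smul_mul (a : permGroup X) (x : X) (g : permGroup X) :
    translate (a • x) (a * g) = a * translate x g := by
  rw [translate_apply, translate_apply, mul_inv_rev, mul_smul, inv_smul_smul, mul_assoc]

variable (X) in
/-- The group of permutations of `𝒢(X)` generated by all `translate x`. -/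
def translations : Subgroup (Equiv.Perm (permGroup X)) :=
  Subgroup.closure (Set.range (translate (X := X)))

theorem translations_comm (S T : translations X) : S * T = T * S := by
  have h : IsMulCommutative (translations X) :=
    Subgroup.isMulCommutative_closure (by
      rintro _ ⟨x, rfl⟩ _ ⟨y, rfl⟩
      exact translate_comm x y)
  exact h.is_comm.comm S T

theorem exists_translation (g : permGroup X) : ∃ T : translations X, T.1 1 = g := by
  obtain ⟨g, hg⟩ := g
  refine Subgroup.closure_induction_right
    (p := fun g hg => ∃ T : translations X, T.1 1 = ⟨g, hg⟩) ⟨1, rfl⟩ ?_ ?_ hg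
  · rintro g hg _ ⟨u, rfl⟩ ⟨T, hT⟩
    refine ⟨⟨(translate ((⟨g, hg⟩ : permGroup X) • op u u))⁻¹,
      inv_mem (Subgroup.subset_closure ⟨_, rfl⟩)⟩ * T, ?_⟩
    change (translate _)⁻¹ (T.1 1) = _
    rw [hT, Equiv.Perm.inv_eq_iff_eq]
    change _ = translate ((⟨g, hg⟩ : permGroup X) • op u u) ((⟨g, hg⟩ : permGroup X) * sig u)
    rw [translate_smul_mul, translate_apply, ← sig_smul, inv_smul_smul, mul_inv_cancel, mul_one]
  · rintro g hg _ ⟨u, rfl⟩ ⟨T, hT⟩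
    refine ⟨⟨translate ((⟨g, hg⟩ : permGroup X) • u), Subgroup.subset_closure ⟨_, rfl⟩⟩ * T, ?_⟩
    change translate _ (T.1 1) = _
    rw [hT, translate_apply, inv_smul_smul]
    rfl

variable (X) in
theorem bijective_eval_one :
    Function.Bijective fun T : translations X => (T.1 1 : permGroup X) := by
  refine ⟨fun S T hST => Subtype.ext (Equiv.ext fun g => ?_), exists_translation⟩
  obtain ⟨R, rfl⟩ := exists_translation g
  have hS : S.1 (R.1 1) = R.1 (S.1 1) :=
    DFunLike.congr_fun (congrArg Subtype.val (translations_comm S R)) 1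
  have hT : T.1 (R.1 1) = R.1 (T.1 1) :=
    DFunLike.congr_fun (congrArg Subtype.val (translations_comm T R)) 1
  rw [hS, hT]
  exact congrArg R.1 hST

/-- The element of `translations X` sending `1` to `g`. -/
noncomputable def translationTo (g : permGroup X) : translations X :=
  (Equiv.ofBijective _ (bijective_eval_one X)).symm g

theorem translationTo_one (g : permGroup X) : (translationTo g).1 1 = g :=
  (Equiv.ofBijective _ (bijective_eval_one X)).apply_symm_apply g

theorem translationTo_eq {g : permGroup X} {T : translations X} (h : T.1 1 = g) :
    translationTo g = T :=
  (bijective_eval_one X).1 ((translationTo_one g).trans h.symm)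

theorem mulLeft_conj_mem (a : permGroup X) (T : Equiv.Perm (permGroup X))
    (hT : T ∈ translations X) :
    Equiv.mulLeft a * T * (Equiv.mulLeft a)⁻¹ ∈ translations X := by
  induction hT using Subgroup.closure_induction with
  | mem T hT =>
    obtain ⟨x, rfl⟩ := hT
    refine Subgroup.subset_closure ⟨a • x, ?_⟩
    rw [eq_mul_inv_iff_mul_eq]
    ext1 g
    exact translate_smul_mul a x g
  | one => rw [mul_one, mul_inv_cancel]; exact one_mem _
  | mul S T _ _ hS hT =>
    have h : Equiv.mulLeft a * (S * T) * (Equiv.mulLeft a)⁻¹ =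
        (Equiv.mulLeft a * S * (Equiv.mulLeft a)⁻¹) *
          (Equiv.mulLeft a * T * (Equiv.mulLeft a)⁻¹) := by group
    rw [h]
    exact mul_mem hS hT
  | inv T _ hT =>
    have h : Equiv.mulLeft a * T⁻¹ * (Equiv.mulLeft a)⁻¹ =
        (Equiv.mulLeft a * T * (Equiv.mulLeft a)⁻¹)⁻¹ := by group
    rw [h]
    exact inv_mem hT

noncomputable instance : Zero (permGroup X) := ⟨1⟩

noncomputable instance : Add (permGroup X) :=
  ⟨fun a b => (translationTo a * translationTo b).1 1⟩

noncomputable instance : Neg (permGroup X) := ⟨fun a => (translationTo a)⁻¹.1 1⟩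

theorem translationTo_id : translationTo (1 : permGroup X) = 1 := translationTo_eq rfl

/-- The left brace structure on `𝒢(X)`: its multiplication is the composition of maps, and its
addition is the only one for which `𝒢(X)` is a left brace with
`g + σ_x⁻¹ = g ∘ σ_{g⁻¹(x)}⁻¹`, that is, `λ_g(σ_x⁻¹) = σ_{g(x)}⁻¹`, for all `g` and `x`. -/
noncomputable instance : LeftBrace (permGroup X) where
  nsmul := nsmulRec
  zsmul := zsmulRec
  add_assoc a b c := by
    change (translationTo ((translationTo a * translationTo b).1 1) * translationTo c).1 1 =
      (translationTo a * translationTo ((translationTo b * translationTo c).1 1)).1 1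
    rw [translationTo_eq rfl, translationTo_eq rfl, mul_assoc]
  zero_add a := by
    change (translationTo 1 * translationTo a).1 1 = a
    rw [translationTo_id, one_mul, translationTo_one]
  add_zero a := by
    change (translationTo a * translationTo 1).1 1 = a
    rw [translationTo_id, mul_one, translationTo_one]
  neg_add_cancel a := by
    change (translationTo ((translationTo a)⁻¹.1 1) * translationTo a).1 1 = 1
    rw [translationTo_eq rfl, inv_mul_cancel]
    rfl
  add_comm a b := by
    change (translationTo a * translationTo b).1 1 = (translationTo b * translationTo a).1 1
    rw [translations_comm]
  mul_add_add a b c := by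
    let C : translations X := ⟨_, mulLeft_conj_mem a _ (translationTo b).2⟩
    have hC : ∀ g, C.1 (a * g) = a * (translationTo b).1 g := by
      intro g
      change a * (translationTo b).1 (a⁻¹ * (a * g)) = _
      rw [inv_mul_cancel_left]
    have hadd : ∀ g h : permGroup X,
        (translationTo g * translationTo h).1 1 = (translationTo g).1 h := by
      intro g h
      change (translationTo g).1 ((translationTo h).1 1) = _
      rw [translationTo_one]
    have hab : translationTo (a * b) = translationTo a * C := by
      rw [translations_comm]
      apply translationTo_eq
      change C.1 ((translationTo a).1 1) = _
      have h := hC 1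
      rw [mul_one, translationTo_one] at h
      rw [translationTo_one, h]
    change (translationTo (a * (translationTo b * translationTo c).1 1) * translationTo a).1 1 =
      (translationTo (a * b) * translationTo (a * c)).1 1
    rw [translations_comm, hadd, hadd, hadd, hab]
    change _ = (translationTo a).1 (C.1 (a * c))
    rw [hC]

theorem add_sig_inv (g : permGroup X) (x : X) :
    g + (sig x)⁻¹ = g * (sig (g⁻¹ • x))⁻¹ := by
  have h : translationTo (sig x)⁻¹ =
      (⟨translate x, Subgroup.subset_closure ⟨x, rfl⟩⟩ : translations X) := by
    apply translationTo_eq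
    change translate x 1 = _
    rw [translate_apply, inv_one, one_smul, one_mul]
  change (translationTo g * translationTo (sig x)⁻¹).1 1 = _
  rw [h, translations_comm]
  change translate x ((translationTo g).1 1) = _
  rw [translationTo_one, translate_apply]

end Brace

end CycleSet

/-! Write B for 𝒢(X), split (B, +) as B_p plus its complement of order prime to p, and use
`λ_g(σ_x⁻¹) = σ_{g(x)}⁻¹` (`lam_sig_inv`).

1 → 3: if B_p is normal, it acts trivially through λ on the complement
(`IsSylowProjector.lam_eq_self`). As |X| is a power of p, B_p is already transitive on X, so the
complement component b of σ_x⁻¹ does not depend on x and is λ-invariant (`exists_lam_invariant`).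
Hence b is an automorphism of X and σ_x⁻¹ = a_x ∘ b with a_x in B_p. In the deformation Y of X by b,
the permutation attached to x is b ∘ σ_x = a_x⁻¹; these generate B_p, and X is the deformation of Y
by b⁻¹. The order of b is prime to p since powers of b are its additive multiples. For a fixed
point, choose a in B_p such that a ∘ b fixes some x; a power of a ∘ b is conjugate to b under B_p,
by an averaging argument (`IsSylowProjector.exists_conj`).

2 → 1: α normalizes 𝒢(Y), and modulo 𝒢(Y) every element of 𝒢(X) becomes a power of α. Thus B_p lies
in the kernel of this reduction, and by cardinality it is the kernel
(`sylow_normal_of_iso_deformation`). -/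

theorem nsmul_eq_of_modEq {A : Type*} [AddCommGroup A] {i j n : ℕ} (h : i ≡ j [MOD n]) {x : A}
    (hx : n • x = 0) : i • x = j • x :=
  nsmul_eq_nsmul_iff_modEq.mpr (h.of_dvd (addOrderOf_dvd_of_nsmul_eq_zero hx))

/-! ### Left braces and the Sylow decomposition of the additive group. -/

namespace LeftBrace

variable {B : Type u} [Group B] [LeftBrace B]

theorem lam_mul (x y z : B) : lam (x * y) z = lam x (lam y z) := by
  have h : x * y * z = x * (y * z) := mul_assoc x y z
  rw [mul_eq_add_lam (x * y), mul_eq_add_lam y, mul_add, add_sub_assoc, add_right_inj] at h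
  rw [h, mul_eq_add_lam x, add_sub_cancel_left]

theorem lam_one (z : B) : lam 1 z = z := by
  have h := mul_eq_add_lam 1 z
  rw [one_mul, ← zero_eq_one, zero_add] at h
  rw [← zero_eq_one, ← h]

/-- Turns the additive order of the invariant element b into its order as a permutation. -/
theorem pow_eq_nsmul {b : B} (hb : lam b b = b) (k : ℕ) : b ^ k = k • b ∧ lam (b ^ k) b = b := by
  induction k with
  | zero => exact ⟨by rw [pow_zero, zero_nsmul, zero_eq_one], by rw [pow_zero, lam_one]⟩
  | succ k ih =>
    refine ⟨?_, ?_⟩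
    · rw [pow_succ, mul_eq_add_lam, ih.2, ih.1, succ_nsmul]
    · rw [pow_succ, lam_mul, hb, ih.2]

section Sylow

variable [Finite B] {p : ℕ} [Fact p.Prime] (P : Sylow p (Multiplicative B))

theorem card_sylow : Nat.card (sylow P) = Nat.card P := rfl

theorem card_sylow_mul_index : Nat.card (sylow P) * P.index = Nat.card B :=
  (P : Subgroup (Multiplicative B)).card_mul_index

theorem card_sylow_coprime_index : (Nat.card (sylow P)).Coprime P.index :=
  P.card_coprime_index

/-- An abelian group has only one Sylow p-subgroup, so it contains every element of p-power order.
-/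
theorem mem_sylow_iff {b : B} : b ∈ sylow P ↔ Nat.card (sylow P) • b = 0 := by
  constructor
  · intro hb
    have h : (⟨Multiplicative.ofAdd b, hb⟩ : P) ^ Nat.card P = 1 := pow_card_eq_one'
    exact congrArg (fun z : P => Multiplicative.toAdd z.1) h
  · intro hb
    have hz : IsPGroup p (Subgroup.zpowers (Multiplicative.ofAdd b)) := by
      obtain ⟨k, hk⟩ := IsPGroup.iff_card.mp P.2
      apply IsPGroup.of_card_dvd_pow (n := k)
      rw [Nat.card_zpowers, ← hk]
      exact orderOf_dvd_of_pow_eq_one hb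
    obtain ⟨Q, hQ⟩ := hz.exists_le_sylow
    have := Sylow.unique_of_normal P inferInstance
    rw [Subsingleton.elim Q P] at hQ
    exact hQ (Subgroup.mem_zpowers _)

theorem lam_mem (x : B) {y : B} (hy : y ∈ sylow P) : lam x y ∈ sylow P :=
  lam_mem_sylow P x hy

theorem nsmul_mem (k : ℕ) {y : B} (hy : y ∈ sylow P) : k • y ∈ sylow P :=
  P.pow_mem hy k

theorem sum_mem {ι : Type*} (s : Finset ι) (f : ι → B) (hf : ∀ i ∈ s, f i ∈ sylow P) :
    ∑ i ∈ s, f i ∈ sylow P :=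
  (Subgroup.toAddSubgroup' (P : Subgroup (Multiplicative B))).sum_mem hf

/-- Multiplication by `k` is the projection of `(B, +)` onto its Sylow `p`-subgroup. -/
structure IsSylowProjector (k : ℕ) : Prop where
  mem : ∀ b : B, k • b ∈ sylow P
  eq_self : ∀ b ∈ sylow P, k • b = b

theorem exists_isSylowProjector : ∃ k, IsSylowProjector P k := by
  obtain ⟨k, hk1, hk0⟩ := Nat.chineseRemainder (card_sylow_coprime_index P) 1 0
  refine ⟨k, fun b => ?_, fun b hb => ?_⟩
  · obtain ⟨l, hl⟩ := (Nat.modEq_zero_iff_dvd.mp hk0)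
    rw [mem_sylow_iff, hl, ← mul_smul, ← mul_assoc, card_sylow_mul_index, mul_comm, mul_smul,
      card_nsmul_eq_zero', smul_zero]
  · rw [nsmul_eq_of_modEq hk1 ((mem_sylow_iff P).mp hb), one_smul]

variable {P} {k : ℕ}

theorem IsSylowProjector.nsmul_sub (hk : IsSylowProjector P k)
    (b : B) : k • (b - k • b) = 0 := by
  rw [_root_.nsmul_sub, hk.eq_self _ (hk.mem b), sub_self]

/-- The multiple `P.index • b` lies in the Sylow subgroup, so the projector fixes it; but the
projector also kills it. -/
theorem IsSylowProjector.index_nsmul (hk : IsSylowProjector P k)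
    {b : B} (hb : k • b = 0) : P.index • b = 0 := by
  have h : P.index • b ∈ sylow P := by
    rw [mem_sylow_iff, ← mul_smul, card_sylow_mul_index]
    exact card_nsmul_eq_zero'
  rw [← hk.eq_self _ h, smul_comm, hb, smul_zero]

/-- If the Sylow subgroup of `(B, +)` is normal in `(B, ∘)`, it acts trivially on its additive
complement. -/
theorem IsSylowProjector.lam_eq_self (hk : IsSylowProjector P k)
    (hN : (sylow P).Normal) {g : B} (hg : g ∈ sylow P) {h : B}
    (hh : k • h = 0) : lam g h = h := by
  have hg' : h⁻¹ * g * h ∈ sylow P := by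
    have := hN.conj_mem g hg h⁻¹
    rwa [inv_inv] at this
  -- Two expansions of g ∘ h = h ∘ (h⁻¹ ∘ g ∘ h). Their Sylow components give `lam h (h⁻¹ * g * h) =
  -- g`, and cancelling g leaves the claim.
  have e : h + lam h (h⁻¹ * g * h) = g + lam g h := by
    rw [← mul_eq_add_lam, ← mul_eq_add_lam]; group
  have e' := congrArg (k • ·) e
  simp only [nsmul_add] at e'
  rw [hh, zero_add, hk.eq_self _ (lam_mem P h hg'), hk.eq_self _ hg, ← map_nsmul, hh, map_zero,
    add_zero] at e'
  rw [e', add_comm, add_left_cancel_iff] at e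
  exact e.symm

/-- Averaging an affine action of a cyclic group of order prime to `p`. -/
theorem IsSylowProjector.exists_conj (hk : IsSylowProjector P k)
    {b : B} (hb : ∀ g, lam g b = b) (hkb : k • b = 0) {a : B}
    (ha : a ∈ sylow P) : ∃ t : ℕ, ∃ s ∈ sylow P, (a * b) ^ t * s = s * b := by
  -- With t ≡ 1 modulo the index and t ≡ 0 modulo |B_p|, the power d = (a ∘ b)^t keeps complement
  -- component b and satisfies d^m = 1.
  obtain ⟨t, ht1, ht0⟩ := Nat.chineseRemainder (card_sylow_coprime_index P).symm 1 0
  have hmb := hk.index_nsmul hkb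
  set m := P.index with hm
  set c := a * b
  have hc : ∀ j : ℕ, c ^ j - k • c ^ j = j • b := by
    intro j
    induction j with
    | zero => rw [pow_zero, ← zero_eq_one, smul_zero, zero_smul, sub_zero]
    | succ j ih =>
      have e : c ^ (j + 1) = c ^ j + (lam (c ^ j) a + b) := by
        rw [pow_succ, mul_eq_add_lam, show c = a * b from rfl, mul_eq_add_lam a, hb, map_add, hb]
      rw [e, nsmul_add, nsmul_add, hkb, hk.eq_self _ (lam_mem P _ ha), succ_nsmul, ← ih]
      abel
  have hct : (c ^ t) ^ m = 1 := by
    obtain ⟨l, hl⟩ := Nat.modEq_zero_iff_dvd.mp ht0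
    rw [← pow_mul, hl, mul_right_comm, card_sylow_mul_index, pow_mul, pow_card_eq_one', one_pow]
  have htb : t • b = b := by
    rw [nsmul_eq_of_modEq ht1 hmb, one_smul]
  set d := c ^ t
  have hd : d - k • d = b := (hc t).trans htb
  -- The Sylow components of the powers of d form the orbit of 0 under the affine map y ↦ k • d +
  -- λ_d(y). Since d^m = 1, summing over one period and dividing by m gives a fixed point.
  have hrec : ∀ i : ℕ, k • d ^ (i + 1) = k • d + lam d (k • d ^ i) := by
    intro i
    rw [pow_succ', mul_eq_add_lam, nsmul_add, map_nsmul]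
  have hsum : ∑ i ∈ Finset.range m, k • d ^ i =
      m • (k • d) + lam d (∑ i ∈ Finset.range m, k • d ^ i) := by
    have h1 : ∑ i ∈ Finset.range m, k • d ^ (i + 1) = ∑ i ∈ Finset.range m, k • d ^ i := by
      have h := Finset.sum_range_succ (fun i => k • d ^ i) m
      rw [Finset.sum_range_succ', hct, pow_zero] at h
      exact add_right_cancel h
    rw [map_sum, ← h1, Finset.sum_congr rfl fun i _ => hrec i, Finset.sum_add_distrib,
      Finset.sum_const, Finset.card_range]
  -- v is the inverse of m modulo |B_p|, so that `v • s` is the average.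
  obtain ⟨v, hv1⟩ : ∃ v, v * m ≡ 1 [MOD Nat.card (sylow P)] := by
    obtain ⟨w, hw1, hw0⟩ := Nat.chineseRemainder (card_sylow_coprime_index P) 1 0
    obtain ⟨v, rfl⟩ := Nat.modEq_zero_iff_dvd.mp hw0
    exact ⟨v, by rwa [mul_comm]⟩
  have hv : ∀ x ∈ sylow P, (v * m) • x = x := by
    intro x hx
    rw [nsmul_eq_of_modEq hv1 ((mem_sylow_iff P).mp hx), one_smul]
  set s := ∑ i ∈ Finset.range m, k • d ^ i
  have hs : s ∈ sylow P := sum_mem P _ _ fun i _ => hk.mem _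
  refine ⟨t, v • s, nsmul_mem P v hs, ?_⟩
  have hfix : v • s = k • d + lam d (v • s) := by
    rw [map_nsmul]
    nth_rewrite 1 [hsum]
    rw [nsmul_add, ← mul_smul, hv _ (hk.mem d)]
  rw [mul_eq_add_lam, mul_eq_add_lam (v • s), hb]
  nth_rewrite 2 [hfix]
  rw [← hd]
  abel

end Sylow
end LeftBrace

/-! ### Transitivity of subgroups of coprime index. -/

/-- By transitivity |X| = |G : G_x| divides |G : S_x| = |Sx| · |G : S|. By coprimality it divides
|Sx|, so the orbit Sx is all of X. -/
theorem MulAction.exists_mem_smul_eq_of_coprime {G X : Type*} [Group G] [MulAction G X] [Finite X]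
    [MulAction.IsPretransitive G X] (S : Subgroup G) (h : (Nat.card X).Coprime S.index)
    (x y : X) : ∃ s ∈ S, s • x = y := by
  have h1 : (MulAction.stabilizer S x).index = (MulAction.stabilizer G x ⊓ S).relIndex S := by
    rw [Subgroup.inf_relIndex_right]; rfl
  have h2 : Nat.card X ∣ (MulAction.orbit S x).ncard := by
    refine h.dvd_of_dvd_mul_right (n := S.index) ?_
    rw [← MulAction.index_stabilizer, h1, Subgroup.relIndex_mul_index inf_le_right,
      ← MulAction.index_stabilizer_of_transitive G x]
    exact Subgroup.index_dvd_of_le inf_le_left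
  have h3 : MulAction.orbit S x = Set.univ := by
    apply Set.eq_of_subset_of_ncard_le (Set.subset_univ _) _ (Set.toFinite _)
    rw [Set.ncard_univ]
    exact Nat.le_of_dvd ((Set.ncard_pos (Set.toFinite _)).mpr ⟨x, MulAction.mem_orbit_self x⟩) h2
  obtain ⟨s, hs⟩ : y ∈ MulAction.orbit S x := h3 ▸ Set.mem_univ y
  exact ⟨s.1, s.2, hs⟩

/-! ### Addition on 𝒢(X) in terms of the generators σ_x⁻¹. -/

namespace CycleSet

open LeftBrace

section Brace

variable {X : Type u} [CycleSet X]

theorem lam_sig_inv (g : permGroup X) (x : X) : lam g (sig x)⁻¹ = (sig (g • x))⁻¹ := by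
  have h : g + (sig (g • x))⁻¹ = g * (sig (g⁻¹ • g • x))⁻¹ := add_sig_inv g (g • x)
  rw [inv_smul_smul, mul_eq_add_lam] at h
  exact (add_left_cancel h).symm

/-- Right multiplication by σ_x⁻¹ or σ_x amounts to adding or subtracting some σ_y⁻¹, so the σ_x⁻¹
also generate the additive group. -/
theorem add_induction {C : permGroup X → Prop} (zero : C 0)
    (add : ∀ g x, C g → C (g + (sig x)⁻¹)) (sub : ∀ g x, C g → C (g - (sig x)⁻¹))
    (g : permGroup X) : C g := by
  obtain ⟨g, hg⟩ := g
  refine Subgroup.closure_induction_right (p := fun g hg => C ⟨g, hg⟩) zero ?_ ?_ hg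
  · rintro g hg _ ⟨x, rfl⟩ h
    have e : (⟨g, hg⟩ : permGroup X) * sig x =
        ⟨g, hg⟩ - (sig (((⟨g, hg⟩ : permGroup X) * sig x) • x))⁻¹ := by
      rw [eq_sub_iff_add_eq, ← lam_sig_inv, ← mul_eq_add_lam, mul_inv_cancel_right]
    have := sub ⟨g, hg⟩ (((⟨g, hg⟩ : permGroup X) * sig x) • x) h
    rw [← e] at this
    exact this
  · rintro g hg _ ⟨x, rfl⟩ h
    have e : (⟨g, hg⟩ : permGroup X) * (sig x)⁻¹ =
        ⟨g, hg⟩ + (sig ((⟨g, hg⟩ : permGroup X) • x))⁻¹ := by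
      rw [← lam_sig_inv, ← mul_eq_add_lam]
    have := add ⟨g, hg⟩ ((⟨g, hg⟩ : permGroup X) • x) h
    rw [← e] at this
    exact this

/-- A group isomorphism from `𝒢(X)` to a left brace is additive as soon as it respects the
addition of the generators `σ_x⁻¹`. -/
theorem map_add_of_map_sig_inv {C : Type*} [Group C] [LeftBrace C] (f : permGroup X →* C)
    (h : ∀ g x, f (lam g (sig x)⁻¹) = lam (f g) (f (sig x)⁻¹)) (a b : permGroup X) :
    f (a + b) = f a + f b := by
  have key : ∀ (a : permGroup X) (x : X), f (a + (sig x)⁻¹) = f a + f (sig x)⁻¹ := by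
    intro a x
    have e : lam a (sig (a⁻¹ • x))⁻¹ = (sig x)⁻¹ := by rw [lam_sig_inv, smul_inv_smul]
    rw [← e, ← mul_eq_add_lam, map_mul, h, ← mul_eq_add_lam]
  induction b using add_induction with
  | zero => rw [add_zero, zero_eq_one, map_one, ← zero_eq_one, add_zero]
  | add g x ih => rw [← add_assoc, key, ih, key, add_assoc]
  | sub g x ih =>
    rw [← add_left_inj (f (sig x)⁻¹), ← key, add_assoc, add_assoc, ← key, sub_add_cancel, ih]

end Brace

/-! ### From a deformation to normality of the Sylow subgroup. -/

theorem mul_sigma_mul_inv {Y : Type v} [CycleSet Y] (β : aut Y) (y : Y) :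
    β.1 * sigma y * β.1⁻¹ = sigma (β.1 y) := by
  rw [mul_inv_eq_iff_eq_mul]
  ext z
  exact β.2 y z

theorem mem_normalizer_permGroup {Y : Type v} [CycleSet Y] (α : aut Y) :
    α.1 ∈ Subgroup.normalizer (permGroup Y : Set (Equiv.Perm Y)) := by
  have key : ∀ (β : aut Y), permGroup Y ≤ (permGroup Y).comap (MulAut.conj β.1).toMonoidHom := by
    intro β
    rw [permGroup, Subgroup.closure_le]
    rintro _ ⟨y, rfl⟩
    exact Subgroup.subset_closure ⟨β.1 y, (mul_sigma_mul_inv β y).symm⟩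
  rw [Subgroup.mem_normalizer_iff]
  refine fun h => ⟨fun hh => key α hh, fun hh => ?_⟩
  have := key α⁻¹ hh
  change α.1⁻¹ * (α.1 * h * α.1⁻¹) * α.1⁻¹⁻¹ ∈ permGroup Y at this
  rwa [show α.1⁻¹ * (α.1 * h * α.1⁻¹) * α.1⁻¹⁻¹ = h by group] at this

/-- If `X` is a deformation of `Y` by an automorphism of order prime to `p`, and `𝒢(Y)` is
as large as the Sylow `p`-subgroup of `𝒢(X)`, then the latter is normal. -/
theorem sylow_normal_of_iso_deformation {X : Type u} [Finite X] [CycleSet X] {p : ℕ}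
    [Fact p.Prime] (P : Sylow p (Multiplicative (permGroup X))) {Y : Type v} [CycleSet Y]
    (α : aut Y) (f : X ≃ Deformation α) (hf : IsIso f)
    (hcard : Nat.card (permGroup Y) = Nat.card (sylow P)) (hα : (orderOf α).Coprime p) :
    (sylow P).Normal := by
  set K : Subgroup (Equiv.Perm Y) := permGroup Y
  let F : X ≃ Y := f
  let N := Subgroup.normalizer (K : Set (Equiv.Perm Y))
  have hαN : α.1 ∈ N := mem_normalizer_permGroup α
  have hσ : ∀ x, F.permCongrHom (sigma x) = α.1 * sigma (F x) := by
    intro x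
    ext y
    change F (op x (F.symm y)) = α.1 (op (F x) y)
    have h : F (op x (F.symm y)) = α.1 (op (F x) (F (F.symm y))) := hf x (F.symm y)
    rw [h, Equiv.apply_symm_apply]
  have hK : ∀ y, sigma y ∈ K := fun y => Subgroup.subset_closure ⟨y, rfl⟩
  have hle : (permGroup X).map F.permCongrHom.toMonoidHom ≤ N := by
    rw [permGroup, MonoidHom.map_closure, Subgroup.closure_le]
    rintro _ ⟨_, ⟨x, rfl⟩, rfl⟩
    change F.permCongrHom (sigma x) ∈ N
    rw [hσ]
    exact mul_mem hαN (Subgroup.le_normalizer (hK _))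
  let Φ : permGroup X →* N :=
    (F.permCongrHom.toMonoidHom.comp (permGroup X).subtype).codRestrict N
      fun g => hle ⟨g.1, g.2, rfl⟩
  have hΦ : Function.Injective Φ := by
    intro a b hab
    exact Subtype.ext (F.permCongrHom.injective (congrArg Subtype.val hab))
  let Ψ : permGroup X →* N ⧸ K.subgroupOf N := (QuotientGroup.mk' _).comp Φ
  -- Transported to Y, each σ_x is α times an element of K, so every generator maps to the class of
  -- α.
  have hΨ : ∀ g, Ψ g ∈ Subgroup.zpowers (QuotientGroup.mk' (K.subgroupOf N) ⟨α.1, hαN⟩) := by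
    rintro ⟨g, hg⟩
    induction hg using Subgroup.closure_induction with
    | mem g hg =>
      obtain ⟨x, rfl⟩ := hg
      have h : Ψ (sig x) = QuotientGroup.mk' (K.subgroupOf N) ⟨α.1, hαN⟩ := by
        refine ((QuotientGroup.mk'_eq_mk' _).mpr ⟨⟨sigma (F x), Subgroup.le_normalizer (hK _)⟩,
          hK (F x), ?_⟩).symm
        exact Subtype.ext (hσ x).symm
      exact h ▸ Subgroup.mem_zpowers _
    | one =>
      change Ψ 1 ∈ _
      rw [map_one]
      exact one_mem _
    | mul a b ha hb iha ihb =>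
      change Ψ (⟨a, ha⟩ * ⟨b, hb⟩) ∈ _
      rw [map_mul]
      exact mul_mem iha ihb
    | inv a ha iha =>
      change Ψ (⟨a, ha⟩⁻¹) ∈ _
      rw [map_inv]
      exact inv_mem iha
  have hker : sylow P ≤ Ψ.ker := by
    intro g hg
    have h1 : orderOf (Ψ g) ∣ orderOf α := by
      obtain ⟨i, hi⟩ := Subgroup.mem_zpowers_iff.mp (hΨ g)
      apply orderOf_dvd_of_pow_eq_one
      have hα1 : (⟨α.1, hαN⟩ : N) ^ orderOf α = 1 :=
        Subtype.ext (show α.1 ^ orderOf α = 1 from congrArg Subtype.val (pow_orderOf_eq_one α))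
      rw [← hi, ← zpow_natCast, zpow_comm, zpow_natCast, ← map_pow, hα1, map_one, one_zpow]
    have h2 : orderOf (Ψ g) ∣ Nat.card (sylow P) :=
      (orderOf_map_dvd Ψ g).trans ((sylow P).orderOf_dvd_natCard hg)
    have h3 : (orderOf α).Coprime (Nat.card (sylow P)) := by
      rw [card_sylow, P.card_eq_multiplicity]
      exact hα.pow_right _
    exact orderOf_eq_one_iff.mp (Nat.eq_one_of_dvd_coprimes h3 h1 h2)
  -- The kernel of Ψ embeds into K, which has as many elements as the Sylow subgroup.
  have hle' : Nat.card Ψ.ker ≤ Nat.card (sylow P) := by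
    have : Finite Y := Finite.of_equiv X F
    rw [← hcard]
    refine Nat.card_le_card_of_injective (fun g : Ψ.ker => (⟨(Φ g.1).1, ?_⟩ : K)) ?_
    · exact (QuotientGroup.eq_one_iff (N := K.subgroupOf N) (Φ g.1)).mp g.2
    · intro a b hab
      have h : (Φ a.1).1 = (Φ b.1).1 := congrArg (fun z : K => z.1) hab
      exact Subtype.ext (hΦ (Subtype.ext h))
  have : sylow P = Ψ.ker := Subgroup.eq_of_le_of_card_ge hker hle'
  rw [this]
  infer_instance

end CycleSet
-- From a normal Sylow subgroup to a deformation.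
namespace CycleSet

open LeftBrace

/-- If the Sylow `p`-subgroup of `𝒢(X)` is normal, then `σ_x⁻¹ = a_x + b = a_x ∘ b` where `a_x`
belongs to the Sylow subgroup and `b` is independent of `x` and invariant under all `λ_g`. -/
theorem exists_lam_invariant {X : Type u} [Finite X] [Nonempty X] [CycleSet X] {p : ℕ}
    [Fact p.Prime] {P : Sylow p (Multiplicative (permGroup X))} (hN : (sylow P).Normal)
    (htrans : ∀ x y : X, ∃ s ∈ sylow P, s • x = y) {k : ℕ} (hk : IsSylowProjector P k) :
    ∃ b : permGroup X, (∀ x : X, (sig x)⁻¹ = k • (sig x)⁻¹ + b) ∧ (∀ g, lam g b = b) ∧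
      k • b = 0 := by
  have hlam : ∀ (g : permGroup X) (x : X), lam g ((sig x)⁻¹ - k • (sig x)⁻¹) =
      (sig (g • x))⁻¹ - k • (sig (g • x))⁻¹ := by
    intro g x
    rw [map_sub, map_nsmul, lam_sig_inv]
  -- Move x to y by an element s of the Sylow subgroup: λ_s carries one complement component to the
  -- other, yet fixes the complement.
  have hconst : ∀ x y : X, (sig x)⁻¹ - k • (sig x)⁻¹ = (sig y)⁻¹ - k • (sig y)⁻¹ := by
    intro x y
    obtain ⟨s, hs, rfl⟩ := htrans x y
    rw [← hlam, hk.lam_eq_self hN hs (hk.nsmul_sub _)]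
  obtain ⟨x⟩ := ‹Nonempty X›
  refine ⟨(sig x)⁻¹ - k • (sig x)⁻¹, fun y => ?_, fun g => ?_, hk.nsmul_sub _⟩
  · rw [hconst x y, add_sub_cancel]
  · rw [hlam, hconst]

section Deform

variable {X : Type u} [CycleSet X]

/-- Elements of `𝒢(X)` that are invariant under all `λ_g` act by automorphisms. -/
theorem mem_aut_of_lam_invariant {b : permGroup X} (hb : ∀ g, lam g b = b) : b.1 ∈ aut X := by
  intro x y
  -- Both sides equal b + σ_{b(x)}⁻¹, the right one because b is λ-invariant.
  have h : b * (sig x)⁻¹ = (sig (b • x))⁻¹ * b := by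
    rw [mul_eq_add_lam, lam_sig_inv, mul_eq_add_lam, hb, add_comm]
  have h' : b * sig x = sig (b • x) * b := by
    rw [eq_inv_mul_iff_mul_eq, ← mul_assoc, mul_inv_eq_iff_eq_mul] at h
    exact h.symm
  exact congrArg (fun g : permGroup X => g.1 y) h'

theorem inv_mem_aut_deformation (β : aut X) : β.1⁻¹ ∈ aut (Deformation β) := by
  intro x y
  change β.1⁻¹ (β.1 (op (X := X) x y)) = β.1 (op (X := X) (β.1⁻¹ x) (β.1⁻¹ y))
  rw [show op (X := X) (β.1⁻¹ x) (β.1⁻¹ y) = β.1⁻¹ (op (X := X) x y) from ((β⁻¹).2 x y).symm]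
  simp

theorem isIso_refl_deformation_inv (β : aut X) :
    IsIso (Y := Deformation (⟨β.1⁻¹, inv_mem_aut_deformation β⟩ : aut (Deformation β)))
      (Equiv.refl X) := by
  intro x y
  change op x y = β.1⁻¹ (β.1 (op (X := X) x y))
  simp

variable [Finite X] {p : ℕ} [Fact p.Prime] {P : Sylow p (Multiplicative (permGroup X))}
  {k : ℕ}

/-- The deformation of `X` by `b` has the Sylow subgroup as its permutation group. -/
theorem nonempty_leftBraceIso_deformation (hk : IsSylowProjector P k) {b : permGroup X}
    (hb : ∀ g, lam g b = b) (hx : ∀ x : X, (sig x)⁻¹ = k • (sig x)⁻¹ + b) (β : aut X)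
    (hβ : β.1 = b.1) : Nonempty (LeftBraceIso (permGroup (Deformation β)) (sylow P)) := by
  let ι : permGroup X →* Equiv.Perm (Deformation β) := (permGroup X).subtype
  have hι : Function.Injective ι := Subtype.val_injective
  let a : X → permGroup X := fun x => k • (sig x)⁻¹
  have ha : ∀ x, a x ∈ sylow P := fun x => hk.mem _
  have hla : ∀ g x, lam g (a x) = a (g • x) := fun g x => by
    rw [map_nsmul, lam_sig_inv]
  have hσ : ∀ x : X, ι (a x) = (sigma (X := Deformation β) x)⁻¹ := by
    intro x
    have h1 : b * sig x = (a x)⁻¹ := by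
      apply eq_inv_of_mul_eq_one_right
      rw [← mul_assoc, mul_eq_add_lam (a x), hb, ← hx, inv_mul_cancel]
    rw [← inv_inv (ι (a x)), ← map_inv, ← h1]
    congr 1
    ext y
    change b.1 (op x y) = β.1 (op (X := X) x y)
    rw [hβ]
  have hadd : ∀ g x, g + a x = g * a (g⁻¹ • x) := fun g x => by
    rw [mul_eq_add_lam, hla, smul_inv_smul]
  have hι_a : ∀ x, ι (a x) ∈ permGroup (Deformation β) := fun x => by
    rw [hσ]
    exact inv_mem (Subgroup.subset_closure ⟨x, rfl⟩)
  -- Projecting σ_x⁻¹ gives a_x, and adding a_x is right multiplication by some a_y. So additive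
  -- induction keeps the projections in the group generated by the a_x.
  have hle : ∀ g : permGroup X, ι (k • g) ∈ permGroup (Deformation β) := by
    intro g
    induction g using add_induction with
    | zero =>
      rw [smul_zero, zero_eq_one, map_one]
      exact one_mem _
    | add g x ih =>
      rw [nsmul_add, hadd, map_mul]
      exact mul_mem ih (hι_a _)
    | sub g x ih =>
      set w := k • (g - (sig x)⁻¹) with hw
      have h : k • g = w * a (w⁻¹ • x) := by
        rw [← hadd, hw, ← nsmul_add, sub_add_cancel]
      rw [h, map_mul] at ih
      exact (Subgroup.mul_mem_cancel_right _ (hι_a _)).mp ih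
  have hrange : (sylow P).map ι = permGroup (Deformation β) := by
    apply le_antisymm
    · rintro _ ⟨g, hg, rfl⟩
      rw [← hk.eq_self g hg]
      exact hle g
    · rw [permGroup, Subgroup.closure_le]
      rintro _ ⟨x, rfl⟩
      refine ⟨(a x)⁻¹, inv_mem (ha x), ?_⟩
      exact (map_inv ι _).trans (inv_eq_iff_eq_inv.mpr (hσ x))
  let e : permGroup (Deformation β) ≃* sylow P :=
    (((sylow P).equivMapOfInjective ι hι).trans (MulEquiv.subgroupCongr hrange)).symm
  have he : ∀ g, ι (e g).1 = g.1 := fun g =>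
    congrArg Subtype.val (e.symm_apply_apply g)
  have hea : ∀ x, (e (sig (X := Deformation β) x)⁻¹).1 = a x := fun x =>
    hι ((he _).trans (hσ x).symm)
  refine ⟨{ e with map_add := map_add_of_map_sig_inv e.toMonoidHom fun g x => ?_ }⟩
  apply Subtype.ext
  change (e (lam g (sig x)⁻¹)).1 = lam (e g).1 (e (sig x)⁻¹).1
  rw [lam_sig_inv, hea, hea]
  refine Eq.trans ?_ (hla (e g).1 x).symm
  exact congrArg a (DFunLike.congr_fun (he g) x).symm

end Deform

end CycleSet

theorem mainTheorem5 {X : Type u} [Finite X] [CycleSet X]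
    (hind : CycleSet.Indecomposable X) (hirr : CycleSet.Irretractable X)
    (p n : ℕ) [Fact p.Prime] (hcard : Nat.card X = p ^ n)
    (P : Sylow p (Multiplicative (CycleSet.permGroup X))) :
    List.TFAE [
      (LeftBrace.sylow P).Normal,
      ∃ (Y : Type u) (_ : CycleSet Y) (α : CycleSet.aut Y),
        (∃ f : X ≃ CycleSet.Deformation α, CycleSet.IsIso f) ∧
        Nonempty (CycleSet.permGroup Y ≃* LeftBrace.sylow P) ∧
        (orderOf α).Coprime p ∧ ∃ y : Y, α.1 y = y,
      ∃ (Y : Type u) (_ : CycleSet Y) (α : CycleSet.aut Y),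
        (∃ f : X ≃ CycleSet.Deformation α, CycleSet.IsIso f) ∧
        Nonempty (LeftBraceIso (CycleSet.permGroup Y) (LeftBrace.sylow P)) ∧
        (orderOf α).Coprime p ∧ ∃ y : Y, α.1 y = y] := by
  tfae_have 3 → 2 := by
    rintro ⟨Y, hY, α, hf, ⟨e⟩, hα⟩
    exact ⟨Y, hY, α, hf, ⟨e.toMulEquiv⟩, hα⟩
  tfae_have 2 → 1 := by
    rintro ⟨Y, hY, α, ⟨f, hf⟩, ⟨e⟩, hα, -⟩
    exact CycleSet.sylow_normal_of_iso_deformation P α f hf (Nat.card_congr e.toEquiv) hα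
  tfae_have 1 → 3 := by
    intro hN
    have hpos : 0 < Nat.card X := hcard ▸ pow_pos (Fact.out : p.Prime).pos n
    have : Nonempty X := (Nat.card_pos_iff.mp hpos).1
    have : MulAction.IsPretransitive (CycleSet.permGroup X) X := hind
    -- `P.index` is an index in (B, +); the index in (B, ∘) agrees because the orders do.
    have hindex : (LeftBrace.sylow P).index = P.index := by
      apply Nat.eq_of_mul_eq_mul_left (Nat.card_pos (α := LeftBrace.sylow P))
      rw [Subgroup.card_mul_index, LeftBrace.card_sylow_mul_index]
    have hpm : p.Coprime P.index :=
      ((Fact.out : p.Prime).coprime_iff_not_dvd).mpr P.not_dvd_index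
    have htrans := MulAction.exists_mem_smul_eq_of_coprime (X := X) (LeftBrace.sylow P)
      (by rw [hcard, hindex]; exact hpm.pow_left n)
    obtain ⟨k, hk⟩ := LeftBrace.exists_isSylowProjector P
    obtain ⟨b, hx, hb, hkb⟩ := CycleSet.exists_lam_invariant hN htrans hk
    let β : CycleSet.aut X := ⟨b.1, CycleSet.mem_aut_of_lam_invariant hb⟩
    refine ⟨CycleSet.Deformation β, inferInstance, ⟨β.1⁻¹, CycleSet.inv_mem_aut_deformation β⟩,
      ⟨Equiv.refl X, CycleSet.isIso_refl_deformation_inv β⟩,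
      CycleSet.nonempty_leftBraceIso_deformation hk hb hx β rfl, ?_, ?_⟩
    · have hbm : b ^ P.index = 1 := by
        rw [(LeftBrace.pow_eq_nsmul (hb b) _).1, hk.index_nsmul hkb, LeftBrace.zero_eq_one]
      refine Nat.Coprime.coprime_dvd_left (orderOf_dvd_of_pow_eq_one ?_) hpm.symm
      apply Subtype.ext
      change (b.1⁻¹) ^ P.index = 1
      rw [inv_pow, inv_eq_one]
      exact congrArg Subtype.val hbm
    · obtain ⟨x⟩ := ‹Nonempty X›
      obtain ⟨a, ha, hax⟩ := htrans (b • x) x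
      obtain ⟨t, s, hs, hc⟩ := hk.exists_conj hb hkb ha
      have hfix : (a * b) ^ t • x = x := by
        have h : a * b ∈ MulAction.stabilizer (CycleSet.permGroup X) x := by
          rw [MulAction.mem_stabilizer_iff, mul_smul, hax]
        exact pow_mem h t
      -- From (a ∘ b)^t ∘ s = s ∘ b, the element b is conjugated by s to a permutation fixing x, so
      -- b fixes s⁻¹(x).
      refine ⟨s⁻¹ • x, ?_⟩
      change b⁻¹ • s⁻¹ • x = s⁻¹ • x
      rw [← mul_smul, ← mul_inv_rev, ← hc, mul_inv_rev, mul_smul, inv_smul_eq_iff.mpr hfix.symm]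
  tfae_finish
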